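/- Let $A$ be a unital $C^*$-algebra over $\mathbb{C}$. A left ideal of $A$ is said to be of finite order if it can be written as a finite (possibly empty) sum of minimal left ideals of $A$. Let $M$ be a Noetherian left $A$-module of finite presentation, and let $n\in\mathbb{N}_0$. If $M$ is generated by $n$ elements, then there exist left ideals $L_1,\dots,L_n\subseteq A$ of finite order such that $$M\cong L_1\oplus\dots\oplus L_n$$ as left $A$-modules. -/

import Mathlib

open scoped DirectSum

/-- A left ideal is of finite order if it is a finite (possibly empty) sum of minimal left ideals.
For a noncommutative ring, `Ideal A` is the type of left ideals of `A`; a minimal left ideal, i.e.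
a minimal element among the nonzero left ideals, is an atom of this lattice. -/
def Ideal.IsOfFiniteOrder {A : Type*} [Ring A] (L : Ideal A) : Prop :=
  ∃ (k : ℕ) (m : Fin k → Ideal A), (∀ j, IsAtom (m j)) ∧ L = ⨆ j, m j

/-!
The analytic input is that a finitely generated left ideal `I` of a unital C⋆-algebra `A` with
Noetherian quotient is a direct summand. The closure `J` of `I` is again finitely generated, since
`J / I` is a submodule of `A / I`. By the open mapping theorem, a module endomorphism of `J` that
moves the generators of `J` by little enough is invertible. As `J` has a right approximate unit and
`I` is dense in `J`, right multiplication by some `e ∈ I` is such an endomorphism, so that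
`J = J e ⊆ I`; composing right multiplication by `e` with the inverse of its restriction to `J` then
projects `A` onto `I`.

Hence every cyclic Noetherian module of finite presentation is projective. The same holds for its
quotients, so it is semisimple, and it embeds into `A` as a left ideal of finite order. Splitting
off one generator at a time gives the decomposition.
-/

open Filter Topology

section Splitting

variable {R M P : Type*} [Ring R] [AddCommGroup M] [Module R M] [AddCommGroup P] [Module R P]

theorem isCompl_ker_of_bijective_comp_subtype {N : Submodule R M} {f : M →ₗ[R] N}
    (hf : Function.Bijective (f ∘ₗ N.subtype)) : IsCompl N (LinearMap.ker f) := by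
  let e : N ≃ₗ[R] N := .ofBijective (f ∘ₗ N.subtype) hf
  rw [← LinearEquiv.ker_comp e.symm f]
  exact LinearMap.isCompl_of_proj fun x => e.symm_apply_apply x

theorem exists_isCompl_ker_of_projective [Module.Projective R P] {f : M →ₗ[R] P}
    (hf : Function.Surjective f) : ∃ C : Submodule R M, IsCompl (LinearMap.ker f) C := by
  obtain ⟨s, hs⟩ := Module.projective_lifting_property f LinearMap.id hf
  have hfs : ∀ p, f (s p) = p := LinearMap.congr_fun hs
  have hidem : IsIdempotentElem (s ∘ₗ f) := LinearMap.ext fun x => congrArg s (hfs (f x))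
  have hker : LinearMap.ker (s ∘ₗ f) = LinearMap.ker f :=
    LinearMap.ker_comp_of_ker_eq_bot f
      (LinearMap.ker_eq_bot.2 (Function.LeftInverse.injective hfs))
  exact ⟨LinearMap.range (s ∘ₗ f), hker ▸ (LinearMap.IsIdempotentElem.isCompl hidem).symm⟩

theorem projective_quotient_of_isCompl [Module.Projective R M] {K C : Submodule R M}
    (h : IsCompl K C) : Module.Projective R (M ⧸ K) :=
  have : Module.Projective R C := .of_split C.subtype (C.projectionOnto K h.symm)
    (LinearMap.ext fun x => C.projectionOnto_apply_left h.symm x)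
  .of_equiv (K.quotientEquivOfIsCompl C h).symm

theorem finitePresentation_of_isCompl [Module.FinitePresentation R M] {N C : Submodule R M}
    (h : IsCompl N C) (hC : C.FG) : Module.FinitePresentation R N :=
  Module.finitePresentation_of_surjective (N.projectionOnto C h) (N.projectionOnto_surjective h)
    (by rwa [Submodule.ker_projectionOnto])

theorem finitePresentation_quotient [Module.FinitePresentation R M] {N : Submodule R M}
    (hN : N.FG) : Module.FinitePresentation R (M ⧸ N) :=
  Module.finitePresentation_of_surjective N.mkQ N.mkQ_surjective (by rwa [N.ker_mkQ])

end Splitting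

theorem isOfFiniteOrder_of_isSemisimpleModule {R : Type*} [Ring R] (L : Ideal R)
    [IsSemisimpleModule R L] [Module.Finite R L] : L.IsOfFiniteOrder := by
  classical
  obtain ⟨k, S, e, hS⟩ := IsSemisimpleModule.exists_linearEquiv_fin_dfinsupp R L
  let f : (Π₀ i, S i) →ₗ[R] R := L.subtype ∘ₗ e.symm
  have hf : Function.Injective f := L.injective_subtype.comp e.symm.injective
  have f_range : LinearMap.range f = L := by
    rw [LinearMap.range_comp_of_range_eq_top _ e.symm.range, L.range_subtype]
  refine ⟨k, fun i => LinearMap.range (f ∘ₗ DFinsupp.lsingle i), fun i => ?_, ?_⟩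
  · have hfi : Function.Injective (f ∘ₗ DFinsupp.lsingle i) :=
      hf.comp (DFinsupp.single_injective (β := fun i => S i) (i := i))
    have : IsSimpleModule R (S i) := hS i
    exact isSimpleModule_iff_isAtom.1 (.congr (LinearEquiv.ofInjective _ hfi).symm)
  · simp only [LinearMap.range_comp]
    rw [← Submodule.map_iSup, DFinsupp.iSup_range_lsingle, Submodule.map_top, f_range]

/-- Rings over which every finitely generated left ideal with Noetherian quotient is a direct
summand. This is the only property of C⋆-algebras that the decomposition of Noetherian modules of
finite presentation depends on. -/
class HasSplitNoetherianQuotients (R : Type*) [Ring R] : Prop where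
  exists_isCompl (I : Ideal R) (hI : I.FG) [IsNoetherian R (R ⧸ I)] : ∃ C : Ideal R, IsCompl I C

namespace HasSplitNoetherianQuotients

variable {R : Type*} [Ring R] [HasSplitNoetherianQuotients R]

section Cyclic

variable {M : Type*} [AddCommGroup M] [Module R M] [IsNoetherian R M]
  [Module.FinitePresentation R M]

theorem projective_of_span_singleton {x : M} (hx : Submodule.span R {x} = ⊤) :
    Module.Projective R M := by
  let f := LinearMap.toSpanSingleton R M x
  have hf : Function.Surjective f := by
    rw [← LinearMap.range_eq_top, LinearMap.range_toSpanSingleton, hx]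
  let e : (R ⧸ LinearMap.ker f) ≃ₗ[R] M := f.quotKerEquivOfSurjective hf
  have : IsNoetherian R (R ⧸ LinearMap.ker f) := isNoetherian_of_linearEquiv e.symm
  obtain ⟨C, hC⟩ := exists_isCompl (LinearMap.ker f) (Module.FinitePresentation.fg_ker f hf)
  have : Module.Projective R (R ⧸ LinearMap.ker f) := projective_quotient_of_isCompl hC
  exact .of_equiv e

theorem exists_isCompl_of_span_mkQ_singleton {N : Submodule R M} {x : M}
    (hx : Submodule.span R {N.mkQ x} = ⊤) : ∃ C : Submodule R M, IsCompl N C := by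
  have := finitePresentation_quotient (IsNoetherian.noetherian N)
  have := projective_of_span_singleton hx
  simpa only [Submodule.ker_mkQ] using exists_isCompl_ker_of_projective N.mkQ_surjective

theorem isSemisimpleModule_of_span_singleton {x : M} (hx : Submodule.span R {x} = ⊤) :
    IsSemisimpleModule R M :=
  (isSemisimpleModule_iff R M).2 ⟨fun N => exists_isCompl_of_span_mkQ_singleton (x := x) <| by
    rw [← Set.image_singleton, ← Submodule.map_span, hx, Submodule.map_top, N.range_mkQ]⟩

theorem exists_isOfFiniteOrder_linearEquiv {x : M} (hx : Submodule.span R {x} = ⊤) :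
    ∃ L : Ideal R, L.IsOfFiniteOrder ∧ Nonempty (M ≃ₗ[R] L) := by
  have := projective_of_span_singleton hx
  have := isSemisimpleModule_of_span_singleton hx
  have hf : LinearMap.range (LinearMap.toSpanSingleton R M x) = ⊤ := by
    rw [LinearMap.range_toSpanSingleton, hx]
  obtain ⟨s, hs⟩ := LinearMap.exists_rightInverse_of_surjective _ hf
  have hs_inj : Function.Injective s :=
    Function.LeftInverse.injective (g := LinearMap.toSpanSingleton R M x) (LinearMap.congr_fun hs)
  let e : M ≃ₗ[R] LinearMap.range s := .ofInjective s hs_inj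
  have : IsSemisimpleModule R (LinearMap.range s) := .range s
  exact ⟨LinearMap.range s, isOfFiniteOrder_of_isSemisimpleModule _, ⟨e⟩⟩

theorem exists_linearEquiv_prod_of_span_mkQ_singleton {N : Submodule R M} {x : M}
    (hx : Submodule.span R {N.mkQ x} = ⊤) :
    Module.FinitePresentation R N ∧
      ∃ L : Ideal R, L.IsOfFiniteOrder ∧ Nonempty (M ≃ₗ[R] L × N) := by
  have := finitePresentation_quotient (IsNoetherian.noetherian N)
  obtain ⟨L, hL, ⟨e⟩⟩ := exists_isOfFiniteOrder_linearEquiv hx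
  obtain ⟨C, hC⟩ := exists_isCompl_of_span_mkQ_singleton hx
  refine ⟨finitePresentation_of_isCompl hC (IsNoetherian.noetherian C), L, hL, ⟨?_⟩⟩
  exact (C.prodEquivOfIsCompl N hC.symm).symm ≪≫ₗ
    ((N.quotientEquivOfIsCompl C hC).symm ≪≫ₗ e).prodCongr (.refl R N)

end Cyclic

end HasSplitNoetherianQuotients

open HasSplitNoetherianQuotients in
theorem mainTheorem12_general {R : Type*} [Ring R] [HasSplitNoetherianQuotients R] {M : Type*}
    [AddCommGroup M] [Module R M] [IsNoetherian R M] [Module.FinitePresentation R M]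
    (n : ℕ) (x : Fin n → M) (hx : Submodule.span R (Set.range x) = ⊤) :
    ∃ L : Fin n → Ideal R, (∀ i, (L i).IsOfFiniteOrder) ∧ Nonempty (M ≃ₗ[R] ∀ i, L i) := by
  induction n generalizing M with
  | zero =>
    rw [Set.range_eq_empty, Submodule.span_empty] at hx
    have : Subsingleton M := (Submodule.subsingleton_iff R).1 (subsingleton_of_bot_eq_top hx)
    exact ⟨Fin.elim0, Fin.rec0, ⟨0⟩⟩
  | succ n ih =>
    let N : Submodule R M := Submodule.span R (Set.range (Fin.tail x))
    have head_span : Submodule.span R {N.mkQ (x 0)} = ⊤ := by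
      rw [← Set.image_singleton, ← Submodule.map_span, Submodule.map_mkQ_eq_top,
        ← Submodule.span_union, ← hx, Fin.range_fin_succ, Set.union_comm, Set.singleton_union]
    have tail_span :
        Submodule.span R (Set.range fun i => (⟨x i.succ, Submodule.subset_span ⟨i, rfl⟩⟩ : N)) =
          ⊤ := by
      refine Submodule.map_injective_of_injective N.injective_subtype ?_
      rw [Submodule.map_span, Submodule.map_top, N.range_subtype, ← Set.range_comp]
      rfl
    obtain ⟨_, L₀, hL₀, ⟨e₀⟩⟩ := exists_linearEquiv_prod_of_span_mkQ_singleton head_span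
    obtain ⟨L, hL, ⟨e⟩⟩ := ih _ tail_span
    exact ⟨Fin.cons L₀ L, Fin.cases hL₀ hL, ⟨e₀ ≪≫ₗ (LinearEquiv.refl R L₀).prodCongr e ≪≫ₗ
      Fin.consLinearEquiv R fun i => ((Fin.cons L₀ L : Fin (n + 1) → Ideal R) i : Type _)⟩⟩

section Banach

variable (𝕜 : Type*) [NontriviallyNormedField 𝕜]

theorem bijective_of_norm_sub_le {E : Type*} [NormedAddCommGroup E] [NormedSpace 𝕜 E]
    [CompleteSpace E] {T : E →ₗ[𝕜] E} {c : ℝ} (hc₀ : 0 ≤ c) (hc₁ : c < 1)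
    (hT : ∀ x, ‖x - T x‖ ≤ c * ‖x‖) : Function.Bijective T := by
  let S : E →L[𝕜] E := (LinearMap.id - T).mkContinuous c hT
  have hS : ‖S‖ < 1 := (LinearMap.mkContinuous_norm_le _ hc₀ hT).trans_lt hc₁
  have one_sub_S : ⇑(1 - S) = T := funext fun x => sub_sub_cancel x (T x)
  exact one_sub_S ▸ ContinuousLinearMap.isUnit_iff_bijective.1 (isUnit_one_sub_of_norm_lt_one hS)

variable {A E ι : Type*} [NormedRing A] [NormedAlgebra 𝕜 A] [CompleteSpace A]
  [NormedAddCommGroup E] [NormedSpace 𝕜 E] [CompleteSpace E] [Module A E] [IsBoundedSMul A E]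
  [IsScalarTower 𝕜 A E] {v : ι → E}

include 𝕜

theorem exists_sum_smul_eq_and_norm_le [Fintype ι] (hv : Submodule.span A (Set.range v) = ⊤) :
    ∃ C > 0, ∀ x : E, ∃ y : ι → A, ∑ i, y i • v i = x ∧ ‖y‖ ≤ C * ‖x‖ := by
  let f : (ι → A) →L[𝕜] E :=
    ⟨(Fintype.linearCombination A v).restrictScalars 𝕜, by
      change Continuous fun y : ι → A => ∑ i, y i • v i
      fun_prop⟩
  have hf : Function.Surjective (Fintype.linearCombination A v) := LinearMap.range_eq_top.1 <|
    (Fintype.range_linearCombination A v).trans hv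
  exact f.exists_preimage_norm_le hf

theorem exists_pos_forall_bijective_of_norm_sub_lt [Finite ι]
    (hv : Submodule.span A (Set.range v) = ⊤) :
    ∃ δ > 0, ∀ T : E →ₗ[A] E, (∀ i, ‖v i - T (v i)‖ < δ) → Function.Bijective T := by
  have := Fintype.ofFinite ι
  obtain ⟨C, hC, hcoeff⟩ := exists_sum_smul_eq_and_norm_le 𝕜 hv
  refine ⟨1 / (2 * (Fintype.card ι * C + 1)), by positivity, fun T hT => ?_⟩
  refine bijective_of_norm_sub_le 𝕜 (T := T.restrictScalars 𝕜) (c := 1 / 2) (by norm_num)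
    (by norm_num) fun x => ?_
  obtain ⟨y, rfl, hy⟩ := hcoeff x
  set x := ∑ i, y i • v i
  have sub_map_eq : x - T x = ∑ i, y i • (v i - T (v i)) := by
    simp only [x, map_sum, map_smul, smul_sub, Finset.sum_sub_distrib]
  calc ‖x - T x‖ ≤ ∑ _i : ι, C * ‖x‖ * (1 / (2 * (Fintype.card ι * C + 1))) := by
        rw [sub_map_eq]
        refine norm_sum_le_of_le _ fun i _ => (norm_smul_le _ _).trans ?_
        gcongr
        exacts [(norm_le_pi_norm y i).trans hy, (hT i).le]
    _ = Fintype.card ι * C / (Fintype.card ι * C + 1) * (1 / 2 * ‖x‖) := by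
        rw [Finset.sum_const, Finset.card_univ, nsmul_eq_mul]
        field_simp
    _ ≤ 1 / 2 * ‖x‖ :=
        mul_le_of_le_one_left (by positivity) (div_le_one_of_le₀ (by linarith) (by positivity))

end Banach

section ApproximateUnit

theorem norm_sub_mul_sq_le {A : Type*} [NonUnitalNormedRing A] [StarRing A] [CStarRing A]
    (a e : A) : ‖a - a * e‖ ^ 2 ≤ (1 + ‖e‖) * ‖star a * a - star a * a * e‖ := by
  set d := star a * a - star a * a * e
  have star_mul_self_eq : star (a - a * e) * (a - a * e) = d - star e * d := by
    simp only [d, star_sub, star_mul]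
    noncomm_ring
  calc ‖a - a * e‖ ^ 2 = ‖d - star e * d‖ := by
        rw [sq, ← CStarRing.norm_star_mul_self, star_mul_self_eq]
    _ ≤ ‖d‖ + ‖star e‖ * ‖d‖ := (norm_sub_le _ _).trans (by gcongr; exact norm_mul_le _ _)
    _ = (1 + ‖e‖) * ‖d‖ := by rw [norm_star]; ring

/-- The ⋆-subalgebra `J ∩ J⋆` attached to a left ideal `J`. It is the largest ⋆-subalgebra contained
in `J`; its two-sided approximate units are right approximate units of `J`. -/
def hereditaryStarSubalgebra (R : Type*) {A : Type*} [CommSemiring R] [StarRing R] [Ring A]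
    [StarRing A] [Algebra R A] [StarModule R A] (J : Ideal A) : NonUnitalStarSubalgebra R A where
  carrier := {x | x ∈ J ∧ star x ∈ J}
  zero_mem' := ⟨J.zero_mem, by simp only [star_zero, J.zero_mem]⟩
  add_mem' hx hy := ⟨J.add_mem hx.1 hy.1, by simpa only [star_add] using J.add_mem hx.2 hy.2⟩
  mul_mem' hx hy :=
    ⟨J.mul_mem_left _ hy.1, by simpa only [star_mul] using J.mul_mem_left _ hx.2⟩
  smul_mem' c x hx := ⟨J.smul_of_tower_mem c hx.1, by
    simpa only [star_smul] using J.smul_of_tower_mem (star c) hx.2⟩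
  star_mem' hx := ⟨hx.2, by simpa only [star_star] using hx.1⟩

theorem exists_rightApproximateUnit {A : Type*} [CStarAlgebra A] {J : Ideal A}
    (hJ : IsClosed (J : Set A)) :
    ∃ l : Filter A, l.NeBot ∧ (∀ᶠ e in l, e ∈ J) ∧ ∀ a ∈ J, Tendsto (a * ·) l (𝓝 a) := by
  let B := hereditaryStarSubalgebra ℂ J
  have : IsClosed (B : Set A) := hJ.inter (hJ.preimage continuous_star)
  let _ := CStarAlgebra.spectralOrder B
  have := CStarAlgebra.spectralOrderedRing B
  let u := CStarAlgebra.approximateUnit B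
  have hu : u.IsIncreasingApproximateUnit := CStarAlgebra.increasingApproximateUnit B
  refine ⟨u.map (↑), inferInstance, eventually_map.2 (.of_forall fun e => e.2.1), fun a ha => ?_⟩
  let b : B := ⟨star a * a, J.mul_mem_left _ ha, by
    simpa only [star_mul, star_star] using J.mul_mem_left _ ha⟩
  have hb : Tendsto (fun e : B => 2 * ‖b - b * e‖) u (𝓝 0) := by
    simpa using ((hu.tendsto_mul_left b).const_sub b).norm.const_mul 2
  have bound : ∀ᶠ e : B in u, ‖a - a * e‖ ^ 2 ≤ 2 * ‖b - b * e‖ := by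
    filter_upwards [hu.eventually_norm] with e he
    calc ‖a - a * e‖ ^ 2 ≤ (1 + ‖e‖) * ‖b - b * e‖ := norm_sub_mul_sq_le a e
      _ ≤ 2 * ‖b - b * e‖ := by gcongr; linarith
  have sq_tendsto : Tendsto (fun e : B => ‖a - a * e‖ ^ 2) u (𝓝 0) :=
    squeeze_zero' (.of_forall fun e => sq_nonneg _) bound hb
  rw [tendsto_map'_iff, tendsto_iff_norm_sub_tendsto_zero]
  simpa [norm_sub_rev, Function.comp_def] using sq_tendsto.sqrt

end ApproximateUnit

section CStarAlgebra

variable {A : Type*} [CStarAlgebra A]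

theorem exists_mem_forall_norm_sub_mul_lt {ι : Type*} [Finite ι] {I : Ideal A} {a : ι → A}
    (ha : ∀ i, a i ∈ I.closure) {δ : ℝ} (hδ : 0 < δ) : ∃ e ∈ I, ∀ i, ‖a i - a i * e‖ < δ := by
  have closed : IsClosed (I.closure : Set A) := I.coe_closure ▸ isClosed_closure
  obtain ⟨l, _, hlI, hl⟩ := exists_rightApproximateUnit closed
  let U : Set A := {e | ∀ i, ‖a i - a i * e‖ < δ}
  have U_open : IsOpen U := by
    simp only [U, Set.ofPred_forall]
    exact isOpen_iInter_of_finite fun i => isOpen_lt (by fun_prop) continuous_const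
  have hlU : ∀ᶠ e in l, e ∈ U := eventually_all.2 fun i => by
    have := ((hl (a i) (ha i)).const_sub (a i)).norm
    rw [sub_self, norm_zero] at this
    exact this.eventually_lt_const hδ
  obtain ⟨e₀, he₀, he₀U⟩ := (hlI.and hlU).exists
  rw [← SetLike.mem_coe, Ideal.coe_closure] at he₀
  obtain ⟨e, heU, heI⟩ := mem_closure_iff.1 he₀ U U_open he₀U
  exact ⟨e, heI, heU⟩

theorem exists_isCompl_of_fg_closure {I : Ideal A} (hI : I.closure.FG) :
    ∃ C : Ideal A, IsCompl I C := by
  set J := I.closure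
  have hIJ : I ≤ J := fun x hx => subset_closure hx
  have hJ : IsClosed (J : Set A) := I.coe_closure ▸ isClosed_closure
  have : IsBoundedSMul A J := .of_norm_smul_le fun b y => norm_mul_le b (y : A)
  have : CompleteSpace J := hJ.completeSpace_coe
  have : Module.Finite A J := .of_fg hI
  obtain ⟨n, a, ha⟩ := Module.Finite.exists_fin (R := A) (M := J)
  obtain ⟨δ, hδ, hbij⟩ := exists_pos_forall_bijective_of_norm_sub_lt ℂ ha
  obtain ⟨e, heI, he⟩ := exists_mem_forall_norm_sub_mul_lt (fun i => (a i).2) hδ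
  have mulRight_bijective := hbij (LinearMap.toSpanSingleton A J ⟨e, hIJ heI⟩ ∘ₗ J.subtype) he
  have hJI : J ≤ I := fun x hx => by
    obtain ⟨y, hy⟩ := mulRight_bijective.2 ⟨x, hx⟩
    have y_mul_e : (y : A) * e = x := congrArg Subtype.val hy
    exact y_mul_e ▸ I.mul_mem_left _ heI
  rw [le_antisymm hIJ hJI]
  exact ⟨_, isCompl_ker_of_bijective_comp_subtype mulRight_bijective⟩

instance : HasSplitNoetherianQuotients A where
  exists_isCompl I hI _ := by
    refine exists_isCompl_of_fg_closure ?_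
    refine Submodule.fg_of_fg_map_of_fg_inf_ker I.mkQ (IsNoetherian.noetherian _) ?_
    rwa [Submodule.ker_mkQ, inf_eq_right.2 fun x hx => subset_closure hx]

end CStarAlgebra

theorem mainTheorem12 {A : Type*} [CStarAlgebra A] {M : Type*} [AddCommGroup M] [Module A M]
    [IsNoetherian A M] [Module.FinitePresentation A M]
    (n : ℕ) (x : Fin n → M) (hx : Submodule.span A (Set.range x) = ⊤) :
    ∃ L : Fin n → Ideal A, (∀ i, (L i).IsOfFiniteOrder) ∧
      Nonempty (M ≃ₗ[A] ⨁ i, L i) := by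
  obtain ⟨L, hL, ⟨e⟩⟩ := mainTheorem12_general n x hx
  exact ⟨L, hL, ⟨e ≪≫ₗ (DirectSum.linearEquivFunOnFintype A (Fin n) fun i => L i).symm⟩⟩
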